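/- **Setting.** Featherweight Java (FJ) expressions are $e ::= x \mid \mathtt{this} \mid e.f \mid e.m(\bar e) \mid \mathtt{new}\ C(\bar e) \mid (C)e$. A class table $CT$ is a finite set of clauses $C\ \mathtt{extends}\ D$, $C.init(\bar C)$, $C.f : C'$, $C.m : \bar C \to C'$; $ext(CT)=\{(C,D) \mid (C\ \mathtt{extends}\ D)\in CT\}$, and for a finite relation $\Sigma$ on class names $<:_\Sigma$ is its reflexive transitive closure. Lookups: $fields(C,CT)=C.init(\bar D)$ if this constructor clause is in $CT$; $field(f,C,CT)$ and $mtype(m,C,CT)$ are read from the clause for $f$ (resp. $m$) in $C$ or, if $C$ has none, are inherited from a direct superclass of $C$. The judgment $\Gamma;CT\vdash e:C$ is FJ expression typing with these lookups and with subtyping $<:_{ext(CT)}$ (rules for variables, field access, invocation, object creation, and up-, down- and stupid casts). *Class types* are $T ::= C \mid U$ with $U$ a class variable. *Context requirements* $R$ are finite sets of bindings $x:T$. *Class table requirements* $CR$ are finite sets of pairs $(CReq, cond)$ with $CReq$ one of $T.\mathtt{extends}:T'$, $T.init(\bar T)$, $T.f:T'$, $T.m:\bar T\to T'$, $(T.m:\bar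 T\to T')_{opt}$, and $cond$ a finite set of equalities and inequalities between class types. Constraints are $T=T'$, $T\ne T'$, $T<:T'$, $T\not<:T'$, and conditional equalities of types or of type sequences. $merge_R(R_1,R_2)$ is $R_1$ together with the bindings in $R_2$ of variables outside $dom(R_1)$, and yields the constraints $R_1(x)=R_2(x)$ for common $x$. $merge_{CR}(CR_1,CR_2)$ keeps each requirement that has no requirement of the same kind and member name on the other side; each pair $(r_1,cond_1)\in CR_1$, $(r_2,cond_2)\in CR_2$ of the same kind and member name, with receivers $T_1,T_2$, is replaced by $(r_1,cond_1\cup\{T_1\neq T_2\})$, $(r_2,cond_2\cup\{T_1\ne T_2\})$, $(r_1,cond_1\cup cond_2\cup\{T_1=T_2\})$ and yields the constraints that the remaining types of $r_1$ and $r_2$ are equal if $T_1=T_2$. Merges of several sets are iterated from left to right. The co-contextual judgment $e : T \mid S\mid R\mid CR$ is given by the following rules, where all class variables introduced are fresh and independent subderivations use disjoint sets of class variables; $S$ always contains the constraints of the premises and of the merges. * $x : U\mid\emptyset\mid\{x:U\}\mid\emptyset$ (also for $\mathtt{this}$). * If $e:T_e\mid S_e\mid R_e\mid CR_e$, then $e.f$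 has type $U$, context requirements $R_e$, and class table requirements $merge_{CR}(CR_e,\{(T_e.f:U,\emptyset)\})$. * If $e:T_e\mid S_e\mid R_e\mid CR_e$ and $\bar e:\bar T\mid\bar S\mid\bar R\mid\overline{CR}$, then $e.m(\bar e)$ has type $U'$, requirements $merge_R(R_e,\bar R)$ and $merge_{CR}(CR_e,\{(T_e.m:\bar U\to U',\emptyset)\},\overline{CR})$, and the further constraints $\bar T<:\bar U$. * If $\bar e:\bar T\mid\bar S\mid\bar R\mid\overline{CR}$, then $\mathtt{new}\ C(\bar e)$ has type $C$, requirements $merge_R(\bar R)$ and $merge_{CR}(\{(C.init(\bar U),\emptyset)\},\overline{CR})$, and the further constraints $\bar T<:\bar U$. * If $e:T_e\mid S_e\mid R_e\mid CR_e$, then $(C)e$ has type $C$, requirements $R_e$, $CR_e$, and further constraints $\{T_e<:C\}$, or $\{C<:T_e,\ C\neq T_e\}$, or $\{C\not<:T_e,\ T_e\not<:C\}$. A substitution $\sigma$ maps class variables to class types. $solve(\Sigma,S)=\sigma$ means that every constraint in $S$ holds after applying $\sigma$, with subtyping read as $<:_\Sigma$ on class names. It is a *ground solution* if no class variable occurs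 in $\sigma(T)$, $\sigma(R)$, $\sigma(CR)$. $CT$ *satisfies* a ground $CR$ if for every $(CReq,cond)\in CR$ whose $cond$ holds: $CT$ contains the required extends clause; $fields$, $field$ or $mtype$ in $CT$ returns the required types; or, for an optional method requirement, every result of $mtype$ is the required signature. **Theorem.** Let $e : T\mid S\mid R\mid CR$, let $\Sigma$ be a finite binary relation on class names, and let $solve(\Sigma,S)=\sigma$ be a ground solution. Then there are a class name $C$, a typing context $\Gamma$ (a finite set of bindings, at most one for each variable) and a class table $CT$ such that 1. $\Gamma;CT\vdash e:C$; 2. $C=\sigma(T)$, $\Gamma\supseteq\sigma(R)$, and $CT$ satisfies $\sigma(CR)$; 3. $ext(CT)=\Sigma$. Moreover, $CT$ can be built from the ground requirements: each of its clauses is an extends clause for a pair in $\Sigma$ or is the clause corresponding to a requirement in $\sigma(CR)$, and each constructor, field and method of a class has at most one clause in $CT$. -/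

import Mathlib

namespace CoFJ

/-! ### Syntax of Featherweight Java expressions -/

abbrev ClassName := String
abbrev FieldName := String
abbrev MethodName := String

/-- Term variables: the self reference `this` and the method parameters. -/
inductive Var where
  | this : Var
  | param : String → Var
  deriving DecidableEq

inductive Expr where
  | var : Var → Expr
  | field : Expr → FieldName → Expr
  | invk : Expr → MethodName → List Expr → Expr
  | new : ClassName → List Expr → Expr
  | cast : ClassName → Expr → Expr

/-- Typing contexts: finite sets of bindings, at most one for each variable. -/
structure Ctx where
  bindings : Finset (Var × ClassName)
  functional : ∀ x C D, (x, C) ∈ bindings → (x, D) ∈ bindings → C = D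

/-! ### Class tables -/

/-- Class table clauses `C extends D`, `C.init(C̄)`, `C.f : C'`, `C.m : C̄ → C'`. -/
inductive Clause where
  | ext : ClassName → ClassName → Clause
  | ctor : ClassName → List ClassName → Clause
  | field : ClassName → FieldName → ClassName → Clause
  | method : ClassName → MethodName → List ClassName → ClassName → Clause
  deriving DecidableEq

/-- What a clause defines: `C.extends`, `C.init`, `C.f` or `C.m`. -/
inductive ClauseDom where
  | ext : ClassName → ClauseDom
  | ctor : ClassName → ClauseDom
  | field : ClassName → FieldName → ClauseDom
  | method : ClassName → MethodName → ClauseDom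
  deriving DecidableEq

def Clause.dom : Clause → ClauseDom
  | .ext C _ => .ext C
  | .ctor C _ => .ctor C
  | .field C f _ => .field C f
  | .method C m _ _ => .method C m

/-- A class table is a finite collection of clauses. -/
abbrev ClassTable := Finset Clause

/-- A (finite) immediate subclass relation. -/
abbrev SubclassRel := Finset (ClassName × ClassName)

/-- The projection of a class table to its immediate subclass relation. -/
def ClassTable.extRel (CT : ClassTable) : SubclassRel :=
  CT.biUnion fun c => match c with
    | .ext C D => {(C, D)}
    | _ => ∅

/-- Constructors, fields and methods are declared at most once in each class. (That a class has at
most one superclass is a property of `CT.extRel` alone.) -/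
def ClassTable.Coherent (CT : ClassTable) : Prop :=
  ∀ c ∈ CT, ∀ c' ∈ CT, (∀ C, c.dom ≠ .ext C) → c.dom = c'.dom → c = c'

/-- Subtyping relative to `Sig`: the reflexive transitive closure. -/
def IsSubtype (Sig : SubclassRel) (C D : ClassName) : Prop :=
  Relation.ReflTransGen (fun A B => (A, B) ∈ Sig) C D

/-- `fields(C, CT) = C.init(D̄)`: the constructor signature of `C`. -/
def Fields (CT : ClassTable) (C : ClassName) (Ds : List ClassName) : Prop :=
  Clause.ctor C Ds ∈ CT

/-- `field(f, C, CT) = C'`: the declaration of `f` in `C`, or else in the nearest superclass. -/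
inductive FieldLookup (CT : ClassTable) (f : FieldName) : ClassName → ClassName → Prop
  | here {C C' : ClassName} : Clause.field C f C' ∈ CT → FieldLookup CT f C C'
  | inherit {C D C' : ClassName} : (∀ B, Clause.field C f B ∉ CT) → Clause.ext C D ∈ CT →
      FieldLookup CT f D C' → FieldLookup CT f C C'

/-- `mtype(m, C, CT) = C̄ → C'`: the declaration of `m` in `C`, or else in the nearest
superclass. -/
inductive MType (CT : ClassTable) (m : MethodName) :
    ClassName → List ClassName → ClassName → Prop
  | here {C : ClassName} {Cs : List ClassName} {C' : ClassName} :
      Clause.method C m Cs C' ∈ CT → MType CT m C Cs C'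
  | inherit {C D : ClassName} {Cs : List ClassName} {C' : ClassName} :
      (∀ Bs B, Clause.method C m Bs B ∉ CT) → Clause.ext C D ∈ CT →
      MType CT m D Cs C' → MType CT m C Cs C'

/-! ### The contextual type system -/

mutual

/-- `Γ; CT ⊢ e : C`. -/
inductive HasType (Γ : Ctx) (CT : ClassTable) : Expr → ClassName → Prop
  | var {x : Var} {C : ClassName} : (x, C) ∈ Γ.bindings → HasType Γ CT (.var x) C
  | field {e : Expr} {f : FieldName} {Ce C : ClassName} :
      HasType Γ CT e Ce → FieldLookup CT f Ce C → HasType Γ CT (.field e f) C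
  | invk {e : Expr} {m : MethodName} {es : List Expr} {Ce C : ClassName}
      {Cs Ds : List ClassName} :
      HasType Γ CT e Ce → HasTypes Γ CT es Cs → MType CT m Ce Ds C →
      List.Forall₂ (IsSubtype CT.extRel) Cs Ds → HasType Γ CT (.invk e m es) C
  | new {C : ClassName} {es : List Expr} {Cs Ds : List ClassName} :
      HasTypes Γ CT es Cs → Fields CT C Ds →
      List.Forall₂ (IsSubtype CT.extRel) Cs Ds → HasType Γ CT (.new C es) C
  | ucast {C D : ClassName} {e : Expr} :
      HasType Γ CT e D → IsSubtype CT.extRel D C → HasType Γ CT (.cast C e) C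
  | dcast {C D : ClassName} {e : Expr} :
      HasType Γ CT e D → IsSubtype CT.extRel C D → C ≠ D → HasType Γ CT (.cast C e) C
  | scast {C D : ClassName} {e : Expr} :
      HasType Γ CT e D → ¬ IsSubtype CT.extRel C D → ¬ IsSubtype CT.extRel D C →
      HasType Γ CT (.cast C e) C

/-- `Γ; CT ⊢ ē : C̄`, pointwise. -/
inductive HasTypes (Γ : Ctx) (CT : ClassTable) : List Expr → List ClassName → Prop
  | nil : HasTypes Γ CT [] []
  | cons {e : Expr} {es : List Expr} {C : ClassName} {Cs : List ClassName} :
      HasType Γ CT e C → HasTypes Γ CT es Cs → HasTypes Γ CT (e :: es) (C :: Cs)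

end

/-! ### Class types, conditions, constraints and requirements -/

/-- Class variables. -/
abbrev CVar := ℕ

/-- Class types: class names and class variables. -/
inductive Ty where
  | cls : ClassName → Ty
  | var : CVar → Ty
  deriving DecidableEq

/-- Substitutions; a class variable that is not bound is mapped to itself. -/
abbrev Subst := CVar → Ty

def Ty.subst (σ : Subst) : Ty → Ty
  | .cls C => .cls C
  | .var U => σ U

def Ty.Ground (T : Ty) : Prop := ∃ C, T = .cls C

inductive CondAtom where
  | eq : Ty → Ty → CondAtom
  | ne : Ty → Ty → CondAtom
  deriving DecidableEq

def CondAtom.subst (σ : Subst) : CondAtom → CondAtom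
  | .eq T T' => .eq (T.subst σ) (T'.subst σ)
  | .ne T T' => .ne (T.subst σ) (T'.subst σ)

def CondAtom.Ground : CondAtom → Prop
  | .eq T T' => T.Ground ∧ T'.Ground
  | .ne T T' => T.Ground ∧ T'.Ground

def CondAtom.Holds : CondAtom → Prop
  | .eq T T' => T = T'
  | .ne T T' => T ≠ T'

/-- Conditions: conjunctions of equalities and inequalities. -/
abbrev Cond := Finset CondAtom

def Cond.subst (σ : Subst) (c : Cond) : Cond := c.image (CondAtom.subst σ)

def Cond.Holds (c : Cond) : Prop := ∀ a ∈ c, a.Holds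

/-- Constraints. `seqEqIf` is the conditional equality of two sequences of class types, which
includes that they have the same length. -/
inductive Constraint where
  | eq : Ty → Ty → Constraint
  | ne : Ty → Ty → Constraint
  | sub : Ty → Ty → Constraint
  | nsub : Ty → Ty → Constraint
  | eqIf : Ty → Ty → Cond → Constraint
  | seqEqIf : List Ty → List Ty → Cond → Constraint
  deriving DecidableEq

/-- Subtyping relative to `Sig` on class types: both are class names, in the relation. -/
def TySubtype (Sig : SubclassRel) (T T' : Ty) : Prop :=
  ∃ C D, T = .cls C ∧ T' = .cls D ∧ IsSubtype Sig C D

/-- Constraint satisfaction by `(Sig, σ)`. -/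
def Sat (Sig : SubclassRel) (σ : Subst) : Constraint → Prop
  | .eq T T' => T.subst σ = T'.subst σ
  | .ne T T' => T.subst σ ≠ T'.subst σ
  | .sub T T' => TySubtype Sig (T.subst σ) (T'.subst σ)
  | .nsub T T' => ¬ TySubtype Sig (T.subst σ) (T'.subst σ)
  | .eqIf T T' c => (c.subst σ).Holds → T.subst σ = T'.subst σ
  | .seqEqIf Ts Ts' c => (c.subst σ).Holds → Ts.map (Ty.subst σ) = Ts'.map (Ty.subst σ)

abbrev ConstraintSet := Finset Constraint

/-- `σ` is a solution of `S` relative to `Sig`. -/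
def Solves (Sig : SubclassRel) (S : ConstraintSet) (σ : Subst) : Prop :=
  ∀ s ∈ S, Sat Sig σ s

/-- Class requirements `T.extends : T'`, `T.init(T̄)`, `T.f : T'`, `T.m : T̄ → T'` and
`(T.m : T̄ → T')_opt`. -/
inductive CReq where
  | ext : Ty → Ty → CReq
  | ctor : Ty → List Ty → CReq
  | field : Ty → FieldName → Ty → CReq
  | method : Ty → MethodName → List Ty → Ty → CReq
  | optMethod : Ty → MethodName → List Ty → Ty → CReq
  deriving DecidableEq

def CReq.subst (σ : Subst) : CReq → CReq
  | .ext T T' => .ext (T.subst σ) (T'.subst σ)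
  | .ctor T Ts => .ctor (T.subst σ) (Ts.map (Ty.subst σ))
  | .field T f T' => .field (T.subst σ) f (T'.subst σ)
  | .method T m Ts T' => .method (T.subst σ) m (Ts.map (Ty.subst σ)) (T'.subst σ)
  | .optMethod T m Ts T' => .optMethod (T.subst σ) m (Ts.map (Ty.subst σ)) (T'.subst σ)

def CReq.Ground : CReq → Prop
  | .ext T T' => T.Ground ∧ T'.Ground
  | .ctor T Ts => T.Ground ∧ ∀ A ∈ Ts, A.Ground
  | .field T _ T' => T.Ground ∧ T'.Ground
  | .method T _ Ts T' => T.Ground ∧ (∀ A ∈ Ts, A.Ground) ∧ T'.Ground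
  | .optMethod T _ Ts T' => T.Ground ∧ (∀ A ∈ Ts, A.Ground) ∧ T'.Ground

/-- The receiver type of a requirement. -/
def CReq.recv : CReq → Ty
  | .ext T _ => T
  | .ctor T _ => T
  | .field T _ _ => T
  | .method T _ _ _ => T
  | .optMethod T _ _ _ => T

/-- Class table requirements: finite sets of conditional class requirements. -/
abbrev CTReq := Finset (CReq × Cond)

def CTReq.subst (σ : Subst) (CR : CTReq) : CTReq :=
  CR.image fun p => (p.1.subst σ, p.2.subst σ)

def CTReq.Ground (CR : CTReq) : Prop :=
  ∀ p ∈ CR, p.1.Ground ∧ ∀ a ∈ p.2, a.Ground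

/-- Context requirements: finite sets of bindings of variables to class types. -/
abbrev CtxReq := Finset (Var × Ty)

def CtxReq.subst (σ : Subst) (R : CtxReq) : CtxReq :=
  R.image fun b => (b.1, b.2.subst σ)

def CtxReq.Ground (R : CtxReq) : Prop := ∀ b ∈ R, b.2.Ground

/-! ### Merging requirements -/

/-- `R` together with the bindings of `R'` of variables outside the domain of `R`; the types of
the common variables are equated. -/
def mergeR (R R' : CtxReq) : CtxReq × ConstraintSet :=
  (R ∪ R'.filter (fun b => b.1 ∉ R.image Prod.fst),
   (R ×ˢ R').biUnion fun p => if p.1.1 = p.2.1 then {.eq p.1.2 p.2.2} else ∅)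

/-- The merge of a sequence of context requirements, from left to right. -/
def mergeRs (Rs : List CtxReq) : CtxReq × ConstraintSet :=
  Rs.foldl (fun acc R => ((mergeR acc.1 R).1, acc.2 ∪ (mergeR acc.1 R).2)) (∅, ∅)

/-- Two requirements overlap if they are of the same kind and about the same field or method
name. -/
def CReq.overlap : CReq → CReq → Bool
  | .ext _ _, .ext _ _ => true
  | .ctor _ _, .ctor _ _ => true
  | .field _ f _, .field _ g _ => decide (f = g)
  | .method _ m _ _, .method _ n _ _ => decide (m = n)
  | .optMethod _ m _ _, .optMethod _ n _ _ => decide (m = n)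
  | _, _ => false

/-- The requirements that replace two overlapping requirements. -/
def mergeReqPair (p q : CReq × Cond) : CTReq :=
  {(p.1, insert (.ne p.1.recv q.1.recv) p.2),
   (q.1, insert (.ne p.1.recv q.1.recv) q.2),
   (p.1, insert (.eq p.1.recv q.1.recv) (p.2 ∪ q.2))}

/-- The constraints that two overlapping requirements generate. -/
def mergeReqConstraints : CReq → CReq → ConstraintSet
  | .ext T₁ T₁', .ext T₂ T₂' => {.eqIf T₁' T₂' {.eq T₁ T₂}}
  | .ctor T₁ Ts₁, .ctor T₂ Ts₂ => {.seqEqIf Ts₁ Ts₂ {.eq T₁ T₂}}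
  | .field T₁ _ T₁', .field T₂ _ T₂' => {.eqIf T₁' T₂' {.eq T₁ T₂}}
  | .method T₁ _ Ts₁ T₁', .method T₂ _ Ts₂ T₂' =>
      {.eqIf T₁' T₂' {.eq T₁ T₂}, .seqEqIf Ts₁ Ts₂ {.eq T₁ T₂}}
  | .optMethod T₁ _ Ts₁ T₁', .optMethod T₂ _ Ts₂ T₂' =>
      {.eqIf T₁' T₂' {.eq T₁ T₂}, .seqEqIf Ts₁ Ts₂ {.eq T₁ T₂}}
  | _, _ => ∅

/-- `merge_CR(CR, CR')`: requirements without an overlapping one on the other side are kept, each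
pair of overlapping requirements is replaced. -/
def mergeCR (CR CR' : CTReq) : CTReq × ConstraintSet :=
  (CR.filter (fun p => ∀ q ∈ CR', p.1.overlap q.1 = false) ∪
     CR'.filter (fun q => ∀ p ∈ CR, p.1.overlap q.1 = false) ∪
     (CR ×ˢ CR').biUnion (fun pq =>
       if pq.1.1.overlap pq.2.1 = true then mergeReqPair pq.1 pq.2 else ∅),
   (CR ×ˢ CR').biUnion fun pq =>
     if pq.1.1.overlap pq.2.1 = true then mergeReqConstraints pq.1.1 pq.2.1 else ∅)

/-- The merge of a sequence of class table requirements, from left to right. -/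
def mergeCRs (CRs : List CTReq) : CTReq × ConstraintSet :=
  CRs.foldl (fun acc CR => ((mergeCR acc.1 CR).1, acc.2 ∪ (mergeCR acc.1 CR).2)) (∅, ∅)

/-! ### The co-contextual type system -/

/-- The constraints `T̄ <: Ū` between sequences of the same length. -/
def subConstraints (Ts : List Ty) (Us : List CVar) : ConstraintSet :=
  (List.zipWith (fun T U => Constraint.sub T (.var U)) Ts Us).toFinset

mutual

/-- `e : T | S | R | CR`. The first index is the set of class variables that the derivation has
introduced; it only serves to express that variables are chosen fresh and that independent
derivations use disjoint sets of variables. -/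
inductive CoType : Finset CVar → Expr → Ty → ConstraintSet → CtxReq → CTReq → Prop
  | var {x : Var} {U : CVar} : CoType {U} (.var x) (.var U) ∅ {(x, .var U)} ∅
  | field {F : Finset CVar} {e : Expr} {f : FieldName} {Te : Ty} {Se : ConstraintSet}
      {Re : CtxReq} {CRe CR : CTReq} {Sf : ConstraintSet} {U : CVar} :
      CoType F e Te Se Re CRe → U ∉ F →
      (CR, Sf) = mergeCR CRe {(.field Te f (.var U), ∅)} →
      CoType (insert U F) (.field e f) (.var U) (Se ∪ Sf) Re CR
  | invk {Fe Fs : Finset CVar} {e : Expr} {m : MethodName} {es : List Expr} {Te : Ty}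
      {Ts : List Ty} {Se Ss Sr Scr : ConstraintSet} {Re R : CtxReq} {Rs : List CtxReq}
      {CRe CR : CTReq} {CRs : List CTReq} {U : CVar} {Us : List CVar} :
      CoType Fe e Te Se Re CRe → CoTypes Fs es Ts Ss Rs CRs → Disjoint Fe Fs →
      Us.length = es.length → (U :: Us).Nodup → (∀ V ∈ U :: Us, V ∉ Fe ∪ Fs) →
      (R, Sr) = mergeRs (Re :: Rs) →
      (CR, Scr) = mergeCRs (CRe :: {(.method Te m (Us.map Ty.var) (.var U), ∅)} :: CRs) →
      CoType (Fe ∪ Fs ∪ (U :: Us).toFinset) (.invk e m es) (.var U)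
        (Ss ∪ Se ∪ subConstraints Ts Us ∪ Sr ∪ Scr) R CR
  | new {Fs : Finset CVar} {C : ClassName} {es : List Expr} {Ts : List Ty}
      {Ss Sr Scr : ConstraintSet} {R : CtxReq} {Rs : List CtxReq} {CR : CTReq}
      {CRs : List CTReq} {Us : List CVar} :
      CoTypes Fs es Ts Ss Rs CRs →
      Us.length = es.length → Us.Nodup → (∀ V ∈ Us, V ∉ Fs) →
      (R, Sr) = mergeRs Rs →
      (CR, Scr) = mergeCRs ({(.ctor (.cls C) (Us.map Ty.var), ∅)} :: CRs) →
      CoType (Fs ∪ Us.toFinset) (.new C es) (.cls C)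
        (Ss ∪ subConstraints Ts Us ∪ Sr ∪ Scr) R CR
  | ucast {F : Finset CVar} {C : ClassName} {e : Expr} {Te : Ty} {Se : ConstraintSet}
      {Re : CtxReq} {CRe : CTReq} :
      CoType F e Te Se Re CRe →
      CoType F (.cast C e) (.cls C) (Se ∪ {.sub Te (.cls C)}) Re CRe
  | dcast {F : Finset CVar} {C : ClassName} {e : Expr} {Te : Ty} {Se : ConstraintSet}
      {Re : CtxReq} {CRe : CTReq} :
      CoType F e Te Se Re CRe →
      CoType F (.cast C e) (.cls C) (Se ∪ {.sub (.cls C) Te} ∪ {.ne (.cls C) Te}) Re CRe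
  | scast {F : Finset CVar} {C : ClassName} {e : Expr} {Te : Ty} {Se : ConstraintSet}
      {Re : CtxReq} {CRe : CTReq} :
      CoType F e Te Se Re CRe →
      CoType F (.cast C e) (.cls C) (Se ∪ {.nsub (.cls C) Te} ∪ {.nsub Te (.cls C)}) Re CRe

/-- Independent derivations for the expressions of a sequence; the constraint sets are united,
the requirements are kept apart. -/
inductive CoTypes : Finset CVar → List Expr → List Ty → ConstraintSet → List CtxReq →
    List CTReq → Prop
  | nil : CoTypes ∅ [] [] ∅ [] []
  | cons {F Fs : Finset CVar} {e : Expr} {es : List Expr} {T : Ty} {Ts : List Ty}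
      {S Ss : ConstraintSet} {R : CtxReq} {Rs : List CtxReq} {CR : CTReq} {CRs : List CTReq} :
      CoType F e T S R CR → CoTypes Fs es Ts Ss Rs CRs → Disjoint F Fs →
      CoTypes (F ∪ Fs) (e :: es) (T :: Ts) (S ∪ Ss) (R :: Rs) (CR :: CRs)

end

/-- The co-contextual typing judgment `e : T | S | R | CR`. -/
def CoTyping (e : Expr) (T : Ty) (S : ConstraintSet) (R : CtxReq) (CR : CTReq) : Prop :=
  ∃ F, CoType F e T S R CR

/-! ### Correspondence -/

/-- `σ(T)`, `σ(R)` and `σ(CR)` are ground. -/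
def GroundSolution (σ : Subst) (T : Ty) (R : CtxReq) (CR : CTReq) : Prop :=
  (T.subst σ).Ground ∧ (R.subst σ).Ground ∧ (CR.subst σ).Ground

/-- A class table satisfies a (ground) class requirement. -/
inductive SatisfiesReq (CT : ClassTable) : CReq → Prop
  | ext {C D : ClassName} : Clause.ext C D ∈ CT → SatisfiesReq CT (.ext (.cls C) (.cls D))
  | ctor {C : ClassName} {Ds : List ClassName} : Fields CT C Ds →
      SatisfiesReq CT (.ctor (.cls C) (Ds.map Ty.cls))
  | field {C C' : ClassName} {f : FieldName} : FieldLookup CT f C C' →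
      SatisfiesReq CT (.field (.cls C) f (.cls C'))
  | method {C C' : ClassName} {m : MethodName} {Ds : List ClassName} : MType CT m C Ds C' →
      SatisfiesReq CT (.method (.cls C) m (Ds.map Ty.cls) (.cls C'))
  | optMethod {C C' : ClassName} {m : MethodName} {Ds : List ClassName} :
      (∀ Es E, MType CT m C Es E → Es = Ds ∧ E = C') →
      SatisfiesReq CT (.optMethod (.cls C) m (Ds.map Ty.cls) (.cls C'))

/-- A class table satisfies class table requirements: every requirement whose condition holds. -/
def ClassTable.Satisfies (CT : ClassTable) (CR : CTReq) : Prop :=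
  ∀ p ∈ CR, p.2.Holds → SatisfiesReq CT p.1

/-- A typing context as a set of bindings of variables to class types. -/
def Ctx.toReq (Γ : Ctx) : CtxReq := Γ.bindings.image fun b => (b.1, Ty.cls b.2)

/-- The correspondence relation `(C, Γ, CT) ▷ σ(T, R, CR)`. -/
def Corresponds (C : ClassName) (Γ : Ctx) (CT : ClassTable) (σ : Subst) (T : Ty) (R : CtxReq)
    (CR : CTReq) : Prop :=
  Ty.cls C = T.subst σ ∧ R.subst σ ⊆ Γ.toReq ∧ CT.Satisfies (CR.subst σ)

/-- The class requirement that a class table clause translates to. -/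
def Clause.toReq : Clause → CReq
  | .ext C D => .ext (.cls C) (.cls D)
  | .ctor C Cs => .ctor (.cls C) (Cs.map Ty.cls)
  | .field C f C' => .field (.cls C) f (.cls C')
  | .method C m Cs C' => .method (.cls C) m (Cs.map Ty.cls) (.cls C')

/-- Apart from the extends clauses given by `Sig`, the class table consists of clauses that
translate ground requirements of `CR`. -/
def ClassTable.BuiltFrom (CT : ClassTable) (Sig : SubclassRel) (CR : CTReq) : Prop :=
  ∀ c ∈ CT, (∃ p ∈ Sig, c = Clause.ext p.1 p.2) ∨ ∃ p ∈ CR, p.1 = c.toReq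

end CoFJ

open CoFJ

/-!
A merge replaces two overlapping requirements by conditional copies of them. Read semantically, it
is nothing but a union: under a substitution that solves the constraints of the merge, the bindings
required after the merge are those required by either side, and the requirements whose conditions
hold after the merge are those whose conditions hold on either side. The one danger is the copy that
carries both conditions: if a requirement overlaps one on the same class whose condition fails, both
of its copies become inactive. This never loses information, because in a derivation every
requirement has an active requirement on the same member of the same class, and the constraints
force it to agree.

Hence the active ground requirements contain those of every subderivation and name each member at
most once, so that, together with the extends clauses of `Sig`, they are themselves the clauses of a
class table; and typing follows by induction on the derivation.
-/

namespace CoFJ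

variable {Sig : SubclassRel} {σ : Subst}

/-! ### Iterated merges -/

section FoldMerge

variable {α β : Type*} [DecidableEq β]

/-- The left-to-right iteration, starting from `acc`, of a merge that produces constraints; both
`mergeRs` and `mergeCRs` are instances. -/
def foldMerge (merge : α → α → α × ConstraintSet) (acc : α × ConstraintSet) (as : List α) :
    α × ConstraintSet :=
  as.foldl (fun acc a => ((merge acc.1 a).1, acc.2 ∪ (merge acc.1 a).2)) acc

theorem Solves.mono {S S' : ConstraintSet} (h : Solves Sig S' σ) (hS : S ⊆ S') : Solves Sig S σ :=
  fun s hs => h s (hS hs)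

theorem solves_union {S S' : ConstraintSet} :
    Solves Sig (S ∪ S') σ ↔ Solves Sig S σ ∧ Solves Sig S' σ :=
  Finset.forall_mem_union

theorem solves_singleton {s : Constraint} : Solves Sig {s} σ ↔ Sat Sig σ s := by
  simp [Solves]

theorem subset_foldMerge (merge : α → α → α × ConstraintSet) (acc : α × ConstraintSet)
    (as : List α) : acc.2 ⊆ (foldMerge merge acc as).2 := by
  induction as generalizing acc with
  | nil => exact subset_rfl
  | cons a as ih =>
    exact Finset.subset_union_left.trans (ih ((merge acc.1 a).1, acc.2 ∪ (merge acc.1 a).2))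

theorem foldMerge_eq_union {merge : α → α → α × ConstraintSet} {Inv : α → Prop}
    {den : α → Finset β}
    (hmerge : ∀ {a b}, Inv a → Inv b → Solves Sig (merge a b).2 σ →
      Inv (merge a b).1 ∧ den (merge a b).1 = den a ∪ den b)
    {acc : α × ConstraintSet} {as : List α} (hacc : Inv acc.1) (has : ∀ a ∈ as, Inv a)
    (hS : Solves Sig (foldMerge merge acc as).2 σ) :
    Inv (foldMerge merge acc as).1 ∧
      ∀ x, x ∈ den (foldMerge merge acc as).1 ↔ x ∈ den acc.1 ∨ ∃ a ∈ as, x ∈ den a := by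
  induction as generalizing acc with
  | nil => simpa [foldMerge] using hacc
  | cons a as ih =>
    obtain ⟨ha, has⟩ := List.forall_mem_cons.1 has
    have hSa := (solves_union.1 (hS.mono (subset_foldMerge merge
      ((merge acc.1 a).1, acc.2 ∪ (merge acc.1 a).2) as))).2
    obtain ⟨hInv, hden⟩ := hmerge hacc ha hSa
    obtain ⟨hInv', hden'⟩ := ih (acc := ((merge acc.1 a).1, acc.2 ∪ (merge acc.1 a).2)) hInv has hS
    refine ⟨hInv', fun x => (hden' x).trans ?_⟩
    rw [hden, Finset.mem_union, or_assoc, List.exists_mem_cons_iff]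

end FoldMerge

theorem solves_biUnion_ite {α β : Type*} {s : Finset α} {t : Finset β} {P : α × β → Prop}
    [DecidablePred P] {f : α × β → ConstraintSet} :
    Solves Sig ((s ×ˢ t).biUnion fun p => if P p then f p else ∅) σ ↔
      ∀ a ∈ s, ∀ b ∈ t, P (a, b) → Solves Sig (f (a, b)) σ := by
  have hite (p : α × β) : Solves Sig (if P p then f p else ∅) σ ↔ (P p → Solves Sig (f p) σ) := by
    split_ifs with hp <;> simp [hp, Solves]
  calc
    _ ↔ ∀ p ∈ s ×ˢ t, Solves Sig (if P p then f p else ∅) σ := by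
      simp only [Solves, Finset.mem_biUnion]
      grind
    _ ↔ _ := by simp only [hite, Finset.mem_product, Prod.forall]; grind

theorem injOn_union_of_forall {α β : Type*} {f : α → β} {s t : Set α} (hs : s.InjOn f)
    (ht : t.InjOn f) (hst : ∀ a ∈ s, ∀ b ∈ t, f a = f b → a = b) : (s ∪ t).InjOn f := by
  rintro a (ha | ha) b (hb | hb) hab
  exacts [hs ha hb hab, hst a ha b hb hab, (hst b hb a ha hab.symm).symm, ht ha hb hab]

/-! ### Merging context requirements -/

/-- Each variable has at most one binding under `σ`. -/
def CtxReq.Functional (σ : Subst) (R : CtxReq) : Prop :=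
  Set.InjOn Prod.fst (R.subst σ : Set (Var × Ty))

theorem solves_mergeR_iff {R R' : CtxReq} :
    Solves Sig (mergeR R R').2 σ ↔
      ∀ b ∈ R.subst σ, ∀ b' ∈ R'.subst σ, b.1 = b'.1 → b = b' := by
  simp only [mergeR, solves_biUnion_ite, CtxReq.subst, Finset.forall_mem_image]
  refine forall₄_congr fun b _ b' _ => forall_congr' fun hx => ?_
  simp [Solves, Sat, Prod.ext_iff, hx]

theorem subst_mergeR {R R' : CtxReq} (hS : Solves Sig (mergeR R R').2 σ) :
    CtxReq.subst σ (mergeR R R').1 = R.subst σ ∪ R'.subst σ := by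
  have hunion : CtxReq.subst σ (mergeR R R').1 =
      R.subst σ ∪ CtxReq.subst σ (R'.filter fun b => b.1 ∉ R.image Prod.fst) :=
    Finset.image_union ..
  rw [hunion]
  refine subset_antisymm (Finset.union_subset_union_right (Finset.image_subset_image
    (Finset.filter_subset _ _))) (Finset.union_subset Finset.subset_union_left ?_)
  intro _ hb
  obtain ⟨b, hbR', rfl⟩ := Finset.mem_image.1 hb
  by_cases hx : b.1 ∈ R.image Prod.fst
  · obtain ⟨d, hd, hdb⟩ := Finset.mem_image.1 hx
    have hdR := Finset.mem_image_of_mem (fun b : Var × Ty => (b.1, b.2.subst σ)) hd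
    rw [← solves_mergeR_iff.1 hS _ hdR _ hb hdb]
    exact Finset.mem_union_left _ hdR
  · exact Finset.mem_union_right _
      (Finset.mem_image_of_mem _ (Finset.mem_filter.2 ⟨hbR', hx⟩))

theorem CtxReq.Functional.mergeR {R R' : CtxReq} (h : R.Functional σ) (h' : R'.Functional σ)
    (hS : Solves Sig (mergeR R R').2 σ) : CtxReq.Functional σ (CoFJ.mergeR R R').1 := by
  rw [CtxReq.Functional, subst_mergeR hS, Finset.coe_union]
  exact injOn_union_of_forall h h' (solves_mergeR_iff.1 hS)

theorem functional_mergeRs_and_mem_subst_iff {Rs : List CtxReq}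
    (hS : Solves Sig (mergeRs Rs).2 σ) (hRs : ∀ R ∈ Rs, CtxReq.Functional σ R) :
    CtxReq.Functional σ (mergeRs Rs).1 ∧
      ∀ b, b ∈ CtxReq.subst σ (mergeRs Rs).1 ↔ ∃ R ∈ Rs, b ∈ CtxReq.subst σ R := by
  have hmerge := foldMerge_eq_union (merge := mergeR) (acc := (∅, ∅)) (den := CtxReq.subst σ)
    (fun h h' hS => ⟨h.mergeR h' hS, subst_mergeR hS⟩)
    (by simp [CtxReq.Functional, CtxReq.subst]) hRs hS
  exact ⟨hmerge.1, fun b => (hmerge.2 b).trans (or_iff_right (Finset.notMem_empty b))⟩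

theorem subst_mergeRs_subset_iff {Rs : List CtxReq} {R : CtxReq}
    (hS : Solves Sig (mergeRs Rs).2 σ) (hRs : ∀ R ∈ Rs, CtxReq.Functional σ R) :
    CtxReq.subst σ (mergeRs Rs).1 ⊆ R ↔ ∀ R' ∈ Rs, CtxReq.subst σ R' ⊆ R := by
  simp only [Finset.subset_iff, (functional_mergeRs_and_mem_subst_iff hS hRs).2]
  grind

/-! ### Active class table requirements -/

open Classical in
/-- The instances under `σ` of the requirements whose conditions hold under `σ`: those that a class
table has to satisfy. -/
noncomputable def CTReq.active (σ : Subst) (CR : CTReq) : Finset CReq :=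
  (CR.filter fun p => (p.2.subst σ).Holds).image fun p => p.1.subst σ

theorem CTReq.mem_active {CR : CTReq} {r : CReq} :
    r ∈ CR.active σ ↔ ∃ p ∈ CR, (p.2.subst σ).Holds ∧ p.1.subst σ = r := by
  simp [CTReq.active, and_assoc]

theorem CTReq.active_singleton (r : CReq) : CTReq.active σ {(r, ∅)} = {r.subst σ} := by
  ext r'
  simp [CTReq.mem_active, Cond.Holds, Cond.subst, eq_comm]

theorem ClassTable.satisfies_subst_iff {CT : ClassTable} {CR : CTReq} :
    CT.Satisfies (CR.subst σ) ↔ ∀ r ∈ CR.active σ, SatisfiesReq CT r := by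
  simp only [ClassTable.Satisfies, CTReq.subst, Finset.forall_mem_image, CTReq.mem_active]
  exact ⟨fun h _ ⟨_, hp, hc, e⟩ => e ▸ h hp hc, fun h p hp hc => h _ ⟨p, hp, hc, rfl⟩⟩

/-- The kind of a requirement, with the field or method name. -/
inductive ReqKind where
  | ext : ReqKind
  | ctor : ReqKind
  | field : FieldName → ReqKind
  | method : MethodName → ReqKind
  | optMethod : MethodName → ReqKind

/-- The kind of a requirement; two requirements overlap if and only if they have the same kind. -/
def CReq.kind : CReq → ReqKind
  | .ext _ _ => .ext
  | .ctor _ _ => .ctor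
  | .field _ f _ => .field f
  | .method _ m _ _ => .method m
  | .optMethod _ m _ _ => .optMethod m

/-- What a requirement constrains, the counterpart of `Clause.dom`. -/
def CReq.dom (r : CReq) : Ty × ReqKind := (r.recv, r.kind)

theorem CReq.overlap_iff {r r' : CReq} : r.overlap r' = true ↔ r.kind = r'.kind := by
  cases r <;> cases r' <;> simp [CReq.overlap, CReq.kind]

theorem CReq.dom_subst (r : CReq) : (r.subst σ).dom = (r.recv.subst σ, r.kind) := by
  cases r <;> rfl

theorem CReq.dom_subst_eq_iff {r r' : CReq} :
    (r.subst σ).dom = (r'.subst σ).dom ↔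
      r.overlap r' = true ∧ r.recv.subst σ = r'.recv.subst σ := by
  rw [CReq.dom_subst, CReq.dom_subst, Prod.mk.injEq, CReq.overlap_iff, and_comm]

/-! ### Merging class table requirements -/

theorem Cond.holds_subst_insert {a : CondAtom} {c : Cond} :
    (Cond.subst σ (insert a c)).Holds ↔ (a.subst σ).Holds ∧ (c.subst σ).Holds := by
  simp [Cond.Holds, Cond.subst]

theorem Cond.holds_subst_union {c c' : Cond} :
    (Cond.subst σ (c ∪ c')).Holds ↔ (c.subst σ).Holds ∧ (c'.subst σ).Holds := by
  simp only [Cond.Holds, Cond.subst, Finset.forall_mem_image, Finset.forall_mem_union]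

theorem mem_mergeCR {CR CR' : CTReq} {x : CReq × Cond} :
    x ∈ (mergeCR CR CR').1 ↔
      (x ∈ CR ∧ ∀ q ∈ CR', x.1.overlap q.1 = false) ∨
      (x ∈ CR' ∧ ∀ p ∈ CR, p.1.overlap x.1 = false) ∨
      ∃ p ∈ CR, ∃ q ∈ CR', p.1.overlap q.1 = true ∧
        (x = (p.1, insert (.ne p.1.recv q.1.recv) p.2) ∨
          x = (q.1, insert (.ne p.1.recv q.1.recv) q.2) ∨
          x = (p.1, insert (.eq p.1.recv q.1.recv) (p.2 ∪ q.2))) := by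
  have hite {P : Prop} [Decidable P] {t : CTReq} : x ∈ (if P then t else ∅) ↔ P ∧ x ∈ t := by
    split_ifs with hP <;> simp [hP]
  simp only [mergeCR, mergeReqPair, Finset.mem_union, Finset.mem_filter, Finset.mem_biUnion,
    Finset.mem_product, hite, Prod.exists (α := CReq × Cond), Finset.mem_insert,
    Finset.mem_singleton, or_assoc, and_assoc, exists_and_left]

theorem solves_mergeReqConstraints_iff {r r' : CReq} (ho : r.overlap r' = true) :
    Solves Sig (mergeReqConstraints r r') σ ↔
      (r.recv.subst σ = r'.recv.subst σ → r.subst σ = r'.subst σ) := by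
  cases r <;> cases r' <;>
    simp_all [CReq.overlap, CReq.subst, CReq.recv, mergeReqConstraints, Solves, Sat, Cond.Holds,
      Cond.subst, CondAtom.subst, CondAtom.Holds, and_comm, imp_and]

theorem solves_mergeCR_iff {CR CR' : CTReq} :
    Solves Sig (mergeCR CR CR').2 σ ↔ ∀ p ∈ CR, ∀ q ∈ CR',
      (p.1.subst σ).dom = (q.1.subst σ).dom → p.1.subst σ = q.1.subst σ := by
  rw [mergeCR, solves_biUnion_ite]
  refine forall₄_congr fun p _ q _ => ?_
  rw [CReq.dom_subst_eq_iff, and_imp]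
  exact forall_congr' solves_mergeReqConstraints_iff

theorem active_mergeCR_subset {CR CR' : CTReq} :
    CTReq.active σ (mergeCR CR CR').1 ⊆ CR.active σ ∪ CR'.active σ := by
  intro r hr
  obtain ⟨x, hx, hc, rfl⟩ := CTReq.mem_active.1 hr
  rw [Finset.mem_union, CTReq.mem_active, CTReq.mem_active]
  rcases mem_mergeCR.1 hx with ⟨hp, -⟩ | ⟨hq, -⟩ | ⟨p, hp, q, hq, -, rfl | rfl | rfl⟩
  · exact .inl ⟨x, hp, hc, rfl⟩
  · exact .inr ⟨x, hq, hc, rfl⟩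
  · exact .inl ⟨p, hp, (Cond.holds_subst_insert.1 hc).2, rfl⟩
  · exact .inr ⟨q, hq, (Cond.holds_subst_insert.1 hc).2, rfl⟩
  · exact .inl ⟨p, hp, (Cond.holds_subst_union.1 (Cond.holds_subst_insert.1 hc).2).1, rfl⟩

theorem subst_mem_active_mergeCR_of_dom_eq {CR CR' : CTReq} {p q : CReq × Cond}
    (hp : p ∈ CR) (hpc : (p.2.subst σ).Holds) (hq : q ∈ CR') (hqc : (q.2.subst σ).Holds)
    (hdom : (p.1.subst σ).dom = (q.1.subst σ).dom) :
    p.1.subst σ ∈ CTReq.active σ (mergeCR CR CR').1 := by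
  obtain ⟨ho, hrecv⟩ := CReq.dom_subst_eq_iff.1 hdom
  exact CTReq.mem_active.2 ⟨_, mem_mergeCR.2 (.inr (.inr ⟨p, hp, q, hq, ho, .inr (.inr rfl)⟩)),
    Cond.holds_subst_insert.2 ⟨hrecv, Cond.holds_subst_union.2 ⟨hpc, hqc⟩⟩, rfl⟩

/-- Every requirement, active or not, has an active one with the same domain; without this, merging
with an inactive requirement can deactivate a requirement. -/
def CTReq.Covered (σ : Subst) (CR : CTReq) : Prop :=
  ∀ p ∈ CR, ∃ r ∈ CR.active σ, r.dom = (p.1.subst σ).dom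

theorem active_left_subset_active_mergeCR {CR CR' : CTReq} (hcov' : CR'.Covered σ) :
    CR.active σ ⊆ CTReq.active σ (mergeCR CR CR').1 := by
  intro r hr
  obtain ⟨p, hp, hpc, rfl⟩ := CTReq.mem_active.1 hr
  by_cases hkept : ∀ q ∈ CR', p.1.overlap q.1 = false
  · exact CTReq.mem_active.2 ⟨p, mem_mergeCR.2 (.inl ⟨hp, hkept⟩), hpc, rfl⟩
  obtain ⟨q, hq, ho⟩ : ∃ q ∈ CR', p.1.overlap q.1 = true := by simpa using hkept
  by_cases hrecv : p.1.recv.subst σ = q.1.recv.subst σ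
  · obtain ⟨_, hr', hdom⟩ := hcov' q hq
    obtain ⟨q', hq', hqc', rfl⟩ := CTReq.mem_active.1 hr'
    exact subst_mem_active_mergeCR_of_dom_eq hp hpc hq' hqc'
      ((CReq.dom_subst_eq_iff.2 ⟨ho, hrecv⟩).trans hdom.symm)
  · exact CTReq.mem_active.2 ⟨_, mem_mergeCR.2 (.inr (.inr ⟨p, hp, q, hq, ho, .inl rfl⟩)),
      Cond.holds_subst_insert.2 ⟨hrecv, hpc⟩, rfl⟩

theorem active_right_subset_active_mergeCR {CR CR' : CTReq} (hcov : CR.Covered σ)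
    (hS : Solves Sig (mergeCR CR CR').2 σ) :
    CR'.active σ ⊆ CTReq.active σ (mergeCR CR CR').1 := by
  intro r hr
  obtain ⟨q, hq, hqc, rfl⟩ := CTReq.mem_active.1 hr
  by_cases hkept : ∀ p ∈ CR, p.1.overlap q.1 = false
  · exact CTReq.mem_active.2 ⟨q, mem_mergeCR.2 (.inr (.inl ⟨hq, hkept⟩)), hqc, rfl⟩
  obtain ⟨p, hp, ho⟩ : ∃ p ∈ CR, p.1.overlap q.1 = true := by simpa using hkept
  by_cases hrecv : p.1.recv.subst σ = q.1.recv.subst σ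
  · obtain ⟨_, hr', hdom⟩ := hcov p hp
    obtain ⟨p', hp', hpc', rfl⟩ := CTReq.mem_active.1 hr'
    have hdom' : (p'.1.subst σ).dom = (q.1.subst σ).dom :=
      hdom.trans (CReq.dom_subst_eq_iff.2 ⟨ho, hrecv⟩)
    rw [← solves_mergeCR_iff.1 hS p' hp' q hq hdom']
    exact subst_mem_active_mergeCR_of_dom_eq hp' hpc' hq hqc hdom'
  · exact CTReq.mem_active.2 ⟨_, mem_mergeCR.2 (.inr (.inr ⟨p, hp, q, hq, ho, .inr (.inl rfl)⟩)),
      Cond.holds_subst_insert.2 ⟨hrecv, hqc⟩, rfl⟩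

theorem active_mergeCR {CR CR' : CTReq} (hcov : CR.Covered σ) (hcov' : CR'.Covered σ)
    (hS : Solves Sig (mergeCR CR CR').2 σ) :
    CTReq.active σ (mergeCR CR CR').1 = CR.active σ ∪ CR'.active σ :=
  active_mergeCR_subset.antisymm (Finset.union_subset
    (active_left_subset_active_mergeCR hcov') (active_right_subset_active_mergeCR hcov hS))

theorem exists_mem_of_mem_mergeCR {CR CR' : CTReq} {x : CReq × Cond}
    (hx : x ∈ (mergeCR CR CR').1) :
    (∃ p ∈ CR, p.1 = x.1) ∨ ∃ q ∈ CR', q.1 = x.1 := by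
  rcases mem_mergeCR.1 hx with ⟨hp, -⟩ | ⟨hq, -⟩ | ⟨p, hp, q, hq, -, rfl | rfl | rfl⟩
  exacts [.inl ⟨x, hp, rfl⟩, .inr ⟨x, hq, rfl⟩, .inl ⟨p, hp, rfl⟩, .inr ⟨q, hq, rfl⟩,
    .inl ⟨p, hp, rfl⟩]

theorem CTReq.Covered.mergeCR {CR CR' : CTReq} (hcov : CR.Covered σ) (hcov' : CR'.Covered σ)
    (hS : Solves Sig (mergeCR CR CR').2 σ) : CTReq.Covered σ (CoFJ.mergeCR CR CR').1 := by
  intro x hx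
  rw [active_mergeCR hcov hcov' hS]
  rcases exists_mem_of_mem_mergeCR hx with ⟨p, hp, e⟩ | ⟨q, hq, e⟩
  · obtain ⟨r, hr, hdom⟩ := hcov p hp
    exact ⟨r, Finset.mem_union_left _ hr, e ▸ hdom⟩
  · obtain ⟨r, hr, hdom⟩ := hcov' q hq
    exact ⟨r, Finset.mem_union_right _ hr, e ▸ hdom⟩

/-- Constructor, field and (non-optional) method requirements, the only ones that the typing rules
generate. -/
def CReq.IsMember : CReq → Prop
  | .ctor _ _ | .field _ _ _ | .method _ _ _ _ => True
  | .ext _ _ | .optMethod _ _ _ _ => False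

theorem CReq.IsMember.subst {r : CReq} (h : r.IsMember) : (r.subst σ).IsMember := by
  cases r <;> exact h

/-- The invariants of the requirements of a derivation whose constraints are solved by `σ`. -/
structure CTReq.WellFormed (σ : Subst) (CR : CTReq) : Prop where
  isMember : ∀ p ∈ CR, p.1.IsMember
  covered : CR.Covered σ
  injOn_dom : Set.InjOn CReq.dom (CR.active σ : Set CReq)

theorem CTReq.WellFormed.empty : CTReq.WellFormed σ ∅ :=
  ⟨by simp, by simp [CTReq.Covered], by simp [CTReq.active]⟩

theorem CTReq.WellFormed.singleton {r : CReq} (hr : r.IsMember) :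
    CTReq.WellFormed σ {(r, ∅)} where
  isMember := by simpa using hr
  covered := by simp [CTReq.Covered, CTReq.active_singleton]
  injOn_dom := by simp [CTReq.active_singleton]

theorem CTReq.WellFormed.mergeCR {CR CR' : CTReq} (h : CR.WellFormed σ) (h' : CR'.WellFormed σ)
    (hS : Solves Sig (mergeCR CR CR').2 σ) :
    CTReq.WellFormed σ (CoFJ.mergeCR CR CR').1 where
  isMember x hx := by
    rcases exists_mem_of_mem_mergeCR hx with ⟨p, hp, e⟩ | ⟨q, hq, e⟩
    exacts [e ▸ h.isMember p hp, e ▸ h'.isMember q hq]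
  covered := h.covered.mergeCR h'.covered hS
  injOn_dom := by
    have hcross : ∀ r ∈ CR.active σ, ∀ r' ∈ CR'.active σ, r.dom = r'.dom → r = r' := by
      intro r hr r' hr' hdom
      obtain ⟨p, hp, -, rfl⟩ := CTReq.mem_active.1 hr
      obtain ⟨q, hq, -, rfl⟩ := CTReq.mem_active.1 hr'
      exact solves_mergeCR_iff.1 hS p hp q hq hdom
    rw [active_mergeCR h.covered h'.covered hS, Finset.coe_union]
    exact injOn_union_of_forall h.injOn_dom h'.injOn_dom hcross

theorem wellFormed_mergeCRs_and_mem_active_iff {CRs : List CTReq}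
    (hS : Solves Sig (mergeCRs CRs).2 σ) (hCRs : ∀ CR ∈ CRs, CTReq.WellFormed σ CR) :
    CTReq.WellFormed σ (mergeCRs CRs).1 ∧
      ∀ r, r ∈ CTReq.active σ (mergeCRs CRs).1 ↔ ∃ CR ∈ CRs, r ∈ CTReq.active σ CR := by
  have hmerge := foldMerge_eq_union (merge := mergeCR) (acc := (∅, ∅)) (den := CTReq.active σ)
    (fun h h' hS => ⟨h.mergeCR h' hS, active_mergeCR h.covered h'.covered hS⟩)
    .empty hCRs hS
  exact ⟨hmerge.1, fun r => (hmerge.2 r).trans (or_iff_right (by simp [CTReq.mem_active]))⟩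

theorem satisfies_mergeCR_iff {CT : ClassTable} {CR CR' : CTReq}
    (hS : Solves Sig (mergeCR CR CR').2 σ) (h : CR.WellFormed σ) (h' : CR'.WellFormed σ) :
    CT.Satisfies (CTReq.subst σ (mergeCR CR CR').1) ↔
      CT.Satisfies (CR.subst σ) ∧ CT.Satisfies (CR'.subst σ) := by
  simp only [ClassTable.satisfies_subst_iff, active_mergeCR h.covered h'.covered hS,
    Finset.forall_mem_union]

theorem satisfies_mergeCRs_iff {CT : ClassTable} {CRs : List CTReq}
    (hS : Solves Sig (mergeCRs CRs).2 σ) (hCRs : ∀ CR ∈ CRs, CTReq.WellFormed σ CR) :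
    CT.Satisfies (CTReq.subst σ (mergeCRs CRs).1) ↔
      ∀ CR ∈ CRs, CT.Satisfies (CTReq.subst σ CR) := by
  simp only [ClassTable.satisfies_subst_iff, (wellFormed_mergeCRs_and_mem_active_iff hS hCRs).2]
  grind

theorem satisfies_singleton_iff {CT : ClassTable} {r : CReq} :
    CT.Satisfies (CTReq.subst σ {(r, ∅)}) ↔ SatisfiesReq CT (r.subst σ) := by
  rw [ClassTable.satisfies_subst_iff, CTReq.active_singleton]
  simp only [Finset.mem_singleton, forall_eq]

/-! ### Invariants of derivations -/

mutual

theorem CoType.wellFormed {F : Finset CVar} {e : Expr} {T : Ty} {S : ConstraintSet} {R : CtxReq}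
    {CR : CTReq} : CoType F e T S R CR → Solves Sig S σ → R.Functional σ ∧ CR.WellFormed σ
  | .var, _ => ⟨by simp [CtxReq.Functional, CtxReq.subst], .empty⟩
  | .field h _ hCR, hS => by
    obtain ⟨rfl, rfl⟩ := Prod.ext_iff.1 hCR
    obtain ⟨hSe, hSf⟩ := solves_union.1 hS
    exact (h.wellFormed hSe).imp_right fun hw => hw.mergeCR (.singleton trivial) hSf
  | .invk h hs _ _ _ _ hR hCR, hS => by
    obtain ⟨rfl, rfl⟩ := Prod.ext_iff.1 hR
    obtain ⟨rfl, rfl⟩ := Prod.ext_iff.1 hCR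
    simp only [solves_union] at hS
    obtain ⟨⟨⟨⟨hSs, hSe⟩, -⟩, hSr⟩, hScr⟩ := hS
    obtain ⟨hRe, hCRe⟩ := h.wellFormed hSe
    obtain ⟨hRs, hCRs⟩ := hs.wellFormed hSs
    exact ⟨(functional_mergeRs_and_mem_subst_iff hSr (List.forall_mem_cons.2 ⟨hRe, hRs⟩)).1,
      (wellFormed_mergeCRs_and_mem_active_iff hScr (List.forall_mem_cons.2
        ⟨hCRe, List.forall_mem_cons.2 ⟨.singleton trivial, hCRs⟩⟩)).1⟩
  | .new hs _ _ _ hR hCR, hS => by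
    obtain ⟨rfl, rfl⟩ := Prod.ext_iff.1 hR
    obtain ⟨rfl, rfl⟩ := Prod.ext_iff.1 hCR
    simp only [solves_union] at hS
    obtain ⟨⟨⟨hSs, -⟩, hSr⟩, hScr⟩ := hS
    obtain ⟨hRs, hCRs⟩ := hs.wellFormed hSs
    exact ⟨(functional_mergeRs_and_mem_subst_iff hSr hRs).1,
      (wellFormed_mergeCRs_and_mem_active_iff hScr
        (List.forall_mem_cons.2 ⟨.singleton trivial, hCRs⟩)).1⟩
  | .ucast h, hS => h.wellFormed (solves_union.1 hS).1
  | .dcast h, hS => h.wellFormed (solves_union.1 (solves_union.1 hS).1).1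
  | .scast h, hS => h.wellFormed (solves_union.1 (solves_union.1 hS).1).1

theorem CoTypes.wellFormed {F : Finset CVar} {es : List Expr} {Ts : List Ty} {S : ConstraintSet}
    {Rs : List CtxReq} {CRs : List CTReq} : CoTypes F es Ts S Rs CRs → Solves Sig S σ →
      (∀ R ∈ Rs, CtxReq.Functional σ R) ∧ ∀ CR ∈ CRs, CTReq.WellFormed σ CR
  | .nil, _ => by simp
  | .cons h hs _, hS => by
    obtain ⟨hS, hSs⟩ := solves_union.1 hS
    obtain ⟨hR, hCR⟩ := h.wellFormed hS
    obtain ⟨hRs, hCRs⟩ := hs.wellFormed hSs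
    exact ⟨List.forall_mem_cons.2 ⟨hR, hRs⟩, List.forall_mem_cons.2 ⟨hCR, hCRs⟩⟩

end

/-! ### Typing at class types -/

theorem tySubtype_cls {C D : ClassName} :
    TySubtype Sig (.cls C) (.cls D) ↔ IsSubtype Sig C D := by
  simp [TySubtype]

theorem forall₂_tySubtype_of_solves {Ts : List Ty} {Us : List CVar}
    (hS : Solves Sig (subConstraints Ts Us) σ) (hlen : Ts.length = Us.length) :
    List.Forall₂ (TySubtype Sig) (Ts.map (Ty.subst σ)) ((Us.map Ty.var).map (Ty.subst σ)) := by
  simp only [List.forall₂_map_left_iff, List.forall₂_map_right_iff]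
  refine List.forall₂_iff_zip.2 ⟨hlen, fun {T U} hTU => hS (.sub T (.var U)) ?_⟩
  rw [subConstraints, List.mem_toFinset, ← List.map_uncurry_zip_eq_zipWith]
  exact List.mem_map.2 ⟨(T, U), hTU, rfl⟩

section Typing

variable {Γ : Ctx} {CT : ClassTable} {C : ClassName} {e : Expr} {es : List Expr} {A B : Ty}
  {As Bs : List Ty}

/-- `Γ; CT ⊢ e : C` where `A` is the class name `C`. With class types as indices, the typing rules
apply directly to the images under `σ` of the types in a derivation. -/
def HasClassType (Γ : Ctx) (CT : ClassTable) (e : Expr) (A : Ty) : Prop :=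
  ∃ C, A = .cls C ∧ HasType Γ CT e C

theorem exists_hasTypes_of_forall₂ (h : List.Forall₂ (HasClassType Γ CT) es As) :
    ∃ Cs : List ClassName, As = Cs.map Ty.cls ∧ HasTypes Γ CT es Cs := by
  induction h with
  | nil => exact ⟨[], rfl, .nil⟩
  | cons he _ ih =>
    obtain ⟨C, rfl, he⟩ := he
    obtain ⟨Cs, rfl, hes⟩ := ih
    exact ⟨C :: Cs, rfl, .cons he hes⟩

theorem HasClassType.field {f : FieldName} (he : HasClassType Γ CT e A)
    (hf : SatisfiesReq CT (.field A f B)) : HasClassType Γ CT (.field e f) B := by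
  obtain ⟨_, rfl, he⟩ := he
  cases hf with | field hf => exact ⟨_, rfl, .field he hf⟩

theorem HasClassType.invk {m : MethodName} (he : HasClassType Γ CT e A)
    (hes : List.Forall₂ (HasClassType Γ CT) es As) (hm : SatisfiesReq CT (.method A m Bs B))
    (hsub : List.Forall₂ (TySubtype CT.extRel) As Bs) :
    HasClassType Γ CT (.invk e m es) B := by
  obtain ⟨_, rfl, he⟩ := he
  obtain ⟨Cs, rfl, htypes⟩ := exists_hasTypes_of_forall₂ hes
  generalize hr : CReq.method _ m Bs B = r at hm
  cases hm <;> cases hr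
  simp only [List.forall₂_map_left_iff, List.forall₂_map_right_iff, tySubtype_cls] at hsub
  exact ⟨_, rfl, .invk he htypes ‹_› hsub⟩

theorem HasClassType.new (hes : List.Forall₂ (HasClassType Γ CT) es As)
    (hc : SatisfiesReq CT (.ctor (.cls C) Bs))
    (hsub : List.Forall₂ (TySubtype CT.extRel) As Bs) :
    HasClassType Γ CT (.new C es) (.cls C) := by
  obtain ⟨Cs, rfl, htypes⟩ := exists_hasTypes_of_forall₂ hes
  generalize hr : CReq.ctor _ Bs = r at hc
  cases hc <;> cases hr
  simp only [List.forall₂_map_left_iff, List.forall₂_map_right_iff, tySubtype_cls] at hsub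
  exact ⟨C, rfl, .new htypes ‹_› hsub⟩

theorem HasClassType.ucast (he : HasClassType Γ CT e A) (hsub : TySubtype CT.extRel A (.cls C)) :
    HasClassType Γ CT (.cast C e) (.cls C) := by
  obtain ⟨_, rfl, he⟩ := he
  exact ⟨C, rfl, .ucast he (tySubtype_cls.1 hsub)⟩

theorem HasClassType.dcast (he : HasClassType Γ CT e A) (hsub : TySubtype CT.extRel (.cls C) A)
    (hne : .cls C ≠ A) : HasClassType Γ CT (.cast C e) (.cls C) := by
  obtain ⟨_, rfl, he⟩ := he
  exact ⟨C, rfl, .dcast he (tySubtype_cls.1 hsub) fun h => hne (h ▸ rfl)⟩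

theorem HasClassType.scast (he : HasClassType Γ CT e A)
    (hsub : ¬ TySubtype CT.extRel (.cls C) A) (hsub' : ¬ TySubtype CT.extRel A (.cls C)) :
    HasClassType Γ CT (.cast C e) (.cls C) := by
  obtain ⟨_, rfl, he⟩ := he
  rw [tySubtype_cls] at hsub hsub'
  exact ⟨C, rfl, .scast he hsub hsub'⟩

mutual

theorem CoType.hasClassType {F : Finset CVar} {e : Expr} {T : Ty} {S : ConstraintSet} {R : CtxReq}
    {CR : CTReq} : CoType F e T S R CR → Solves CT.extRel S σ → R.subst σ ⊆ Γ.toReq →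
      CT.Satisfies (CR.subst σ) → HasClassType Γ CT e (T.subst σ)
  | .var (x := x) (U := U), _, hΓ, _ => by
    obtain ⟨⟨_, C⟩, hC, e⟩ := Finset.mem_image.1
      (hΓ (Finset.mem_image_of_mem _ (Finset.mem_singleton_self (x, Ty.var U))))
    obtain ⟨rfl, hU⟩ := Prod.ext_iff.1 e
    exact ⟨C, hU.symm, .var hC⟩
  | .field h _ hCR, hS, hΓ, hCT => by
    obtain ⟨rfl, rfl⟩ := Prod.ext_iff.1 hCR
    obtain ⟨hSe, hSf⟩ := solves_union.1 hS
    obtain ⟨hCTe, hf⟩ :=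
      (satisfies_mergeCR_iff hSf (h.wellFormed hSe).2 (.singleton trivial)).1 hCT
    exact (h.hasClassType hSe hΓ hCTe).field (satisfies_singleton_iff.1 hf)
  | .invk h hs _ hlen _ _ hR hCR, hS, hΓ, hCT => by
    obtain ⟨rfl, rfl⟩ := Prod.ext_iff.1 hR
    obtain ⟨rfl, rfl⟩ := Prod.ext_iff.1 hCR
    simp only [solves_union] at hS
    obtain ⟨⟨⟨⟨hSs, hSe⟩, hsub⟩, hSr⟩, hScr⟩ := hS
    obtain ⟨hRe, hCRe⟩ := h.wellFormed hSe
    obtain ⟨hRs, hCRs⟩ := hs.wellFormed hSs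
    rw [subst_mergeRs_subset_iff hSr (List.forall_mem_cons.2 ⟨hRe, hRs⟩),
      List.forall_mem_cons] at hΓ
    rw [satisfies_mergeCRs_iff hScr (List.forall_mem_cons.2
      ⟨hCRe, List.forall_mem_cons.2 ⟨.singleton trivial, hCRs⟩⟩), List.forall_mem_cons,
      List.forall_mem_cons, satisfies_singleton_iff] at hCT
    obtain ⟨hCTe, hm, hCTs⟩ := hCT
    have hes := hs.hasClassTypes hSs hΓ.2 hCTs
    have hlenTs := (List.length_map _).symm.trans (hes.length_eq.symm.trans hlen.symm)
    exact (h.hasClassType hSe hΓ.1 hCTe).invk hes hm (forall₂_tySubtype_of_solves hsub hlenTs)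
  | .new hs hlen _ _ hR hCR, hS, hΓ, hCT => by
    obtain ⟨rfl, rfl⟩ := Prod.ext_iff.1 hR
    obtain ⟨rfl, rfl⟩ := Prod.ext_iff.1 hCR
    simp only [solves_union] at hS
    obtain ⟨⟨⟨hSs, hsub⟩, hSr⟩, hScr⟩ := hS
    obtain ⟨hRs, hCRs⟩ := hs.wellFormed hSs
    rw [subst_mergeRs_subset_iff hSr hRs] at hΓ
    rw [satisfies_mergeCRs_iff hScr (List.forall_mem_cons.2 ⟨.singleton trivial, hCRs⟩),
      List.forall_mem_cons, satisfies_singleton_iff] at hCT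
    have hes := hs.hasClassTypes hSs hΓ hCT.2
    have hlenTs := (List.length_map _).symm.trans (hes.length_eq.symm.trans hlen.symm)
    exact .new hes hCT.1 (forall₂_tySubtype_of_solves hsub hlenTs)
  | .ucast h, hS, hΓ, hCT => by
    rw [solves_union, solves_singleton] at hS
    exact (h.hasClassType hS.1 hΓ hCT).ucast hS.2
  | .dcast h, hS, hΓ, hCT => by
    simp only [solves_union, solves_singleton] at hS
    exact (h.hasClassType hS.1.1 hΓ hCT).dcast hS.1.2 hS.2
  | .scast h, hS, hΓ, hCT => by
    simp only [solves_union, solves_singleton] at hS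
    exact (h.hasClassType hS.1.1 hΓ hCT).scast hS.1.2 hS.2

theorem CoTypes.hasClassTypes {F : Finset CVar} {es : List Expr} {Ts : List Ty}
    {S : ConstraintSet} {Rs : List CtxReq} {CRs : List CTReq} :
    CoTypes F es Ts S Rs CRs → Solves CT.extRel S σ → (∀ R ∈ Rs, CtxReq.subst σ R ⊆ Γ.toReq) →
      (∀ CR ∈ CRs, CT.Satisfies (CTReq.subst σ CR)) →
      List.Forall₂ (HasClassType Γ CT) es (Ts.map (Ty.subst σ))
  | .nil, _, _, _ => .nil
  | .cons h hs _, hS, hΓ, hCT => by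
    obtain ⟨hS, hSs⟩ := solves_union.1 hS
    obtain ⟨hΓ, hΓs⟩ := List.forall_mem_cons.1 hΓ
    obtain ⟨hCT, hCTs⟩ := List.forall_mem_cons.1 hCT
    exact .cons (h.hasClassType hS hΓ hCT) (hs.hasClassTypes hSs hΓs hCTs)

end

end Typing

/-! ### Typing contexts and class tables from ground requirements -/

theorem exists_ctx_toReq_eq {R : CtxReq} (hR : Set.InjOn Prod.fst (R : Set (Var × Ty)))
    (hg : R.Ground) : ∃ Γ : Ctx, Γ.toReq = R := by
  obtain ⟨B, -, rfl⟩ : ∃ B : Finset (Var × ClassName), (B : Set (Var × ClassName)) ⊆ Set.univ ∧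
      B.image (fun b => (b.1, Ty.cls b.2)) = R := by
    refine Finset.subset_set_image_iff.1 fun b hb => ?_
    obtain ⟨C, hC⟩ := hg b hb
    exact ⟨(b.1, C), trivial, Prod.ext rfl hC.symm⟩
  refine ⟨⟨B, fun x C D hC hD => ?_⟩, rfl⟩
  exact Ty.cls.inj (congrArg Prod.snd (hR (Finset.mem_image_of_mem _ hC)
    (Finset.mem_image_of_mem _ hD) rfl))

theorem Clause.toReq_injective : Function.Injective Clause.toReq := by
  have hcls : Function.Injective Ty.cls := fun _ _ => Ty.cls.inj
  rintro (_ | _ | _ | _) (_ | _ | _ | _) <;>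
    simp [Clause.toReq, (List.map_injective_iff.2 hcls).eq_iff]

theorem Clause.dom_toReq_eq {c c' : Clause} (h : c.dom = c'.dom) : c.toReq.dom = c'.toReq.dom := by
  cases c <;> cases c' <;> simp_all [Clause.dom, Clause.toReq, CReq.dom, CReq.recv, CReq.kind]

theorem satisfiesReq_toReq {CT : ClassTable} {c : Clause} (hc : c ∈ CT) :
    SatisfiesReq CT c.toReq := by
  cases c with
  | ext => exact .ext hc
  | ctor => exact .ctor hc
  | field => exact .field (.here hc)
  | method => exact .method (.here hc)

instance : CanLift Ty ClassName Ty.cls Ty.Ground where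
  prf _ := fun ⟨C, hC⟩ => ⟨C, hC.symm⟩

theorem CReq.IsMember.exists_toReq_eq {r : CReq} (hr : r.IsMember) (hg : r.Ground) :
    ∃ c : Clause, c.toReq = r := by
  cases r with
  | ctor T Ts =>
    obtain ⟨hT, hTs⟩ := hg
    lift T to ClassName using hT
    lift Ts to List ClassName using hTs
    exact ⟨.ctor T Ts, rfl⟩
  | field T f T' =>
    obtain ⟨hT, hT'⟩ := hg
    lift T to ClassName using hT
    lift T' to ClassName using hT'
    exact ⟨.field T f T', rfl⟩
  | method T m Ts T' =>
    obtain ⟨hT, hTs, hT'⟩ := hg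
    lift T to ClassName using hT
    lift Ts to List ClassName using hTs
    lift T' to ClassName using hT'
    exact ⟨.method T m Ts T', rfl⟩
  | ext => exact hr.elim
  | optMethod => exact hr.elim

theorem mem_extRel {CT : ClassTable} {p : ClassName × ClassName} :
    p ∈ CT.extRel ↔ Clause.ext p.1 p.2 ∈ CT := by
  simp only [ClassTable.extRel, Finset.mem_biUnion]
  constructor
  · rintro ⟨_ | _ | _ | _, hc, hp⟩ <;> simp_all
  · exact fun h => ⟨_, h, Finset.mem_singleton_self p⟩

/-- The class table with immediate subclass relation `Sig` and member declarations `D`. -/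
def ClassTable.ofDecls (Sig : SubclassRel) (D : Finset Clause) : ClassTable :=
  Sig.image (fun p => .ext p.1 p.2) ∪ D

theorem ClassTable.mem_ofDecls {D : Finset Clause} {c : Clause} :
    c ∈ ClassTable.ofDecls Sig D ↔ (∃ p ∈ Sig, c = .ext p.1 p.2) ∨ c ∈ D := by
  simp [ClassTable.ofDecls, eq_comm]

theorem ClassTable.extRel_ofDecls {D : Finset Clause} (hD : ∀ C C', Clause.ext C C' ∉ D) :
    (ClassTable.ofDecls Sig D).extRel = Sig := by
  ext ⟨C, C'⟩
  simp [mem_extRel, ClassTable.mem_ofDecls, hD]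

theorem ClassTable.coherent_ofDecls {D : Finset Clause}
    (hD : Set.InjOn Clause.dom (D : Set Clause)) : (ClassTable.ofDecls Sig D).Coherent := by
  have hmem {c : Clause} (hc : c ∈ ClassTable.ofDecls Sig D) (hne : ∀ C, c.dom ≠ .ext C) :
      c ∈ D := by
    rcases ClassTable.mem_ofDecls.1 hc with ⟨p, -, rfl⟩ | hc
    exacts [(hne p.1 rfl).elim, hc]
  exact fun c hc c' hc' hne hdom => hD (hmem hc hne) (hmem hc' (hdom ▸ hne)) hdom

theorem CTReq.WellFormed.exists_classTable {CR : CTReq} (h : CR.WellFormed σ)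
    (hg : CTReq.Ground (CR.subst σ)) (Sig : SubclassRel) :
    ∃ CT : ClassTable, CT.extRel = Sig ∧ CT.Coherent ∧ CT.BuiltFrom Sig (CR.subst σ) ∧
      CT.Satisfies (CR.subst σ) := by
  have hmem {r : CReq} (hr : r ∈ CR.active σ) :
      r.IsMember ∧ ∃ p ∈ CR.subst σ, p.1 = r := by
    obtain ⟨p, hp, -, rfl⟩ := CTReq.mem_active.1 hr
    exact ⟨(h.isMember p hp).subst, _, Finset.mem_image_of_mem _ hp, rfl⟩
  obtain ⟨D, -, hD⟩ : ∃ D : Finset Clause, (D : Set Clause) ⊆ Set.univ ∧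
      D.image Clause.toReq = CR.active σ := by
    refine Finset.subset_set_image_iff.1 fun r hr => ?_
    obtain ⟨hr, p, hp, rfl⟩ := hmem hr
    obtain ⟨c, hc⟩ := hr.exists_toReq_eq (hg p hp).1
    exact ⟨c, trivial, hc⟩
  have hDactive {c : Clause} (hc : c ∈ D) : c.toReq ∈ CR.active σ :=
    hD ▸ Finset.mem_image_of_mem _ hc
  refine ⟨ClassTable.ofDecls Sig D, ClassTable.extRel_ofDecls ?_, ClassTable.coherent_ofDecls ?_,
    fun c hc => (ClassTable.mem_ofDecls.1 hc).imp_right fun hc => (hmem (hDactive hc)).2, ?_⟩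
  · exact fun C C' hc => (hmem (hDactive hc)).1
  · exact fun c hc c' hc' hdom => Clause.toReq_injective
      (h.injOn_dom (hDactive hc) (hDactive hc') (Clause.dom_toReq_eq hdom))
  · rw [ClassTable.satisfies_subst_iff, ← hD, Finset.forall_mem_image]
    exact fun c hc => satisfiesReq_toReq (ClassTable.mem_ofDecls.2 (.inr hc))

end CoFJ

theorem mainTheorem2 (e : Expr) (T : Ty) (S : ConstraintSet) (R : CtxReq) (CR : CTReq)
    (Sig : SubclassRel) (σ : Subst)
    (hty : CoTyping e T S R CR) (hsolve : Solves Sig S σ) (hground : GroundSolution σ T R CR) :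
    ∃ (C : ClassName) (Γ : Ctx) (CT : ClassTable),
      HasType Γ CT e C ∧ Corresponds C Γ CT σ T R CR ∧ CT.extRel = Sig ∧
        CT.Coherent ∧ CT.BuiltFrom Sig (CR.subst σ) := by
  obtain ⟨F, hF⟩ := hty
  obtain ⟨-, hgR, hgCR⟩ := hground
  obtain ⟨hR, hCR⟩ := hF.wellFormed hsolve
  obtain ⟨Γ, hΓ⟩ := exists_ctx_toReq_eq hR hgR
  obtain ⟨CT, rfl, hcoh, hbuilt, hsat⟩ := hCR.exists_classTable hgCR Sig
  obtain ⟨C, hC, he⟩ := hF.hasClassType hsolve hΓ.ge hsat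
  exact ⟨C, Γ, CT, he, ⟨hC.symm, hΓ.ge, hsat⟩, rfl, hcoh, hbuilt⟩
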